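/- Let $\mathcal C$ be a semi-abelian category, that is, a pointed category with binary coproducts that is Barr exact and Bourn protomodular. In any category, an object $P$ is called projective if every morphism from $P$ to the codomain of a regular epimorphism lifts along that regular epimorphism. For an object $B$ of $\mathcal C$, a split extension of $B$ consists of morphisms $k\colon X\to E$, $p\colon E\to B$, $s\colon B\to E$ with $k$ a kernel of $p$ and $p s=1_B$. These are the objects of a category $\mathrm{SSE}_B(\mathcal C)$, in which a morphism from $(k,p,s)$ to $(k',p',s')$ is a pair $f\colon X\to X'$, $g\colon E\to E'$ with $gk=k'f$, $p'g=p$ and $gs=s'$. A split extension of $B$ is projective in $\mathrm{SSE}_B(\mathcal C)$ if every regular epimorphism onto it in $\mathrm{SSE}_B(\mathcal C)$ is a split epimorphism in $\mathrm{SSE}_B(\mathcal C)$. The cosmash products are the kernels $h_{A,B}\colon A\diamond B\to A+B$ of the canonical morphism $A+B\to A\times B$, and $h_{A,B,D}\colon A\diamond B\diamond D\to A+B+D$ of the canonical morphism $A+B+D\to (A+B)\times(A+D)\times(B+D)$; they are functorial. The morphisms $(1\;1)+1\colon A+A+B\to A+B$ and $1+(1\;1)\colon A+B+B\to A+B$ restrict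 to folding morphisms $S_{2,1}^{A,B}\colon A\diamond A\diamond B\to A\diamond B$ and $S_{1,2}^{A,B}\colon A\diamond B\diamond B\to A\diamond B$. The conjugation action core of $A$ is $\overline{\chi_A}=(1_A\;1_A)\,h_{A,A}\colon A\diamond A\to A$. The action core of a split extension $(k\colon X\to E,\ p\colon E\to A,\ s\colon A\to E)$ is the unique $\psi\colon A\diamond X\to X$ with $k\psi=(s\;k)\,h_{A,X}$. An internal crossed module $(X,A,\psi,\partial)$ consists of a morphism $\partial\colon X\to A$ and a morphism $\psi\colon A\diamond X\to X$ that is the action core of some split extension of $A$ with kernel object $X$, such that $$\partial\psi=\overline{\chi_A}(1_A\diamond\partial),\qquad \psi(\partial\diamond 1_X)=\overline{\chi_X},\qquad \psi S_{1,2}^{A,X}=\psi S_{2,1}^{A,X}(1_A\diamond\partial\diamond 1_X).$$ A morphism $(X,A,\psi,\partial)\to(X',A',\psi',\partial')$ in the category $\mathrm{XMod}(\mathcal C)$ of internal crossed modules is a pair $f_X\colon X\to X'$, $f_A\colon A\to A'$ with $f_A\partial=\partial' f_X$ and $f_X\psi=\psi'(f_A\diamond f_X)$. Every kernel $k\colon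 Y\to Z$ is a crossed module $(Y,Z,\overline\chi,k)$, where $\overline\chi\colon Z\diamond Y\to Y$ is the unique morphism with $k\overline\chi=\overline{\chi_Z}(1_Z\diamond k)$. **Theorem.** Let $P$ be a projective object of $\mathcal C$ and let $$0\longrightarrow Q\xrightarrow{\ \partial'\ } Z\underset{s}{\overset{p}{\rightleftarrows}} P\longrightarrow 0$$ be a split extension of $P$ that is projective in $\mathrm{SSE}_P(\mathcal C)$. Then the kernel $\partial'\colon Q\to Z$, with its crossed module structure $(Q,Z,\overline\chi,\partial')$, is a projective object of $\mathrm{XMod}(\mathcal C)$. -/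

import Mathlib

open CategoryTheory CategoryTheory.Limits

universe v u

namespace SemiAb

noncomputable section

variable {C : Type u} [Category.{v} C]

/-- A split extension `0 ⟶ X ⟶ E ⇄ B ⟶ 0` of `B` with kernel object `X`, in a category with zero
morphisms: `k` is a kernel of `p`, and `s` is a chosen section of `p`. -/
structure SplitExtension [HasZeroMorphisms C] (B X : C) where
  /-- the middle object -/
  E : C
  /-- the kernel -/
  k : X ⟶ E
  /-- the split epimorphism -/
  p : E ⟶ B
  /-- the chosen section -/
  s : B ⟶ E
  s_p : s ≫ p = 𝟙 B
  k_p : k ≫ p = 0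
  isKernel : Nonempty (IsLimit (KernelFork.ofι k k_p))

variable (C) in
/-- Semi-abelian categories: pointed, Barr exact (regular, and every internal equivalence relation
is effective), Bourn protomodular (in the pointed case: the Split Short Five Lemma holds), with
binary coproducts. -/
class SemiAbelian [HasZeroMorphisms C] : Prop extends Regular C, HasZeroObject C where
  hasBinaryCoproducts : HasBinaryCoproducts C
  effective : ∀ {R X : C} (p₁ p₂ : R ⟶ X), IsEquivalenceRelation p₁ p₂ →
    IsEffectiveEquivalenceRelation p₁ p₂
  splitShortFive : ∀ {B X B' X' : C} (S : SplitExtension B X) (S' : SplitExtension B' X')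
    (f : X ⟶ X') (g : S.E ⟶ S'.E) (l : B ⟶ B'), S.k ≫ g = f ≫ S'.k → S.p ≫ l = g ≫ S'.p →
    S.s ≫ g = l ≫ S'.s → IsIso f → IsIso l → IsIso g

attribute [instance] SemiAbelian.hasBinaryCoproducts

/-- An object is projective (with respect to regular epimorphisms) if every morphism from it lifts
along every regular epimorphism. -/
def IsProjective {D : Type*} [Category* D] (P : D) : Prop :=
  ∀ ⦃Y Y' : D⦄ (e : Y ⟶ Y') (f : P ⟶ Y'), IsRegularEpi e → ∃ g : P ⟶ Y, g ≫ e = f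

/-! ### Split extensions over a fixed object -/

section SSE

variable [HasZeroMorphisms C]

/-- The objects of the category of split extensions over `B`. -/
structure SSE (B : C) where
  /-- the kernel object -/
  X : C
  /-- the split extension of `B` with kernel object `X` -/
  ext : SplitExtension B X

/-- A morphism of split extensions over `B`: morphisms between the kernel objects and between the
middle objects, compatible with the kernels, the split epimorphisms and the sections, and with
the identity on `B`. -/
@[ext]
structure SSE.Hom {B : C} (S T : SSE B) where
  /-- the morphism between the kernel objects -/
  f : S.X ⟶ T.X
  /-- the morphism between the middle objects -/
  g : S.ext.E ⟶ T.ext.E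
  k_g : S.ext.k ≫ g = f ≫ T.ext.k
  g_p : g ≫ T.ext.p = S.ext.p
  s_g : S.ext.s ≫ g = T.ext.s

instance SSE.instCategory (B : C) : Category (SSE B) where
  Hom := SSE.Hom
  id S := ⟨𝟙 _, 𝟙 _, by simp, by simp, by simp⟩
  comp a b := ⟨a.f ≫ b.f, a.g ≫ b.g, by rw [← Category.assoc, a.k_g, Category.assoc, b.k_g,
    Category.assoc], by rw [Category.assoc, b.g_p, a.g_p], by rw [← Category.assoc, a.s_g, b.s_g]⟩
  id_comp a := SSE.Hom.ext (Category.id_comp _) (Category.id_comp _)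
  comp_id a := SSE.Hom.ext (Category.comp_id _) (Category.comp_id _)
  assoc a b c := SSE.Hom.ext (Category.assoc _ _ _) (Category.assoc _ _ _)

/-- A split extension over `B` is projective if every regular epimorphism onto it in the category
of split extensions over `B` is a split epimorphism in that category. -/
def SSE.IsProjective {B : C} (S : SSE B) : Prop :=
  ∀ ⦃T : SSE B⦄ (e : T ⟶ S), IsRegularEpi e → IsSplitEpi e

end SSE

/-! ### Cosmash products -/

variable [HasZeroMorphisms C] [SemiAbelian C]

/-- The comparison morphism `A + B ⟶ A × B`, with matrix the identity matrix. -/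
def sigma₂ (A B : C) : A ⨿ B ⟶ A ⨯ B :=
  coprod.desc (prod.lift (𝟙 A) 0) (prod.lift 0 (𝟙 B))

/-- The binary cosmash product `A ⋄ B`, the kernel of `A + B ⟶ A × B`. -/
def cosmash (A B : C) : C := kernel (sigma₂ A B)

/-- The inclusion `A ⋄ B ⟶ A + B`. -/
def cosmashι (A B : C) : cosmash A B ⟶ A ⨿ B := kernel.ι (sigma₂ A B)

instance (A B : C) : Mono (cosmashι A B) := inferInstanceAs (Mono (kernel.ι _))

lemma cosmashι_fst (A B : C) : cosmashι A B ≫ coprod.desc (𝟙 A) 0 = 0 := by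
  have h : cosmashι A B ≫ sigma₂ A B = 0 := kernel.condition _
  have := congrArg (· ≫ prod.fst) h
  simpa [sigma₂, Category.assoc, coprod.desc_comp, prod.lift_fst, prod.lift_snd] using this

lemma cosmashι_snd (A B : C) : cosmashι A B ≫ coprod.desc 0 (𝟙 B) = 0 := by
  have h : cosmashι A B ≫ sigma₂ A B = 0 := kernel.condition _
  have := congrArg (· ≫ prod.snd) h
  simpa [sigma₂, Category.assoc, coprod.desc_comp, prod.lift_fst, prod.lift_snd] using this

/-- A morphism into `A + B` that both canonical projections send to zero factors through
`A ⋄ B`. -/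
def cosmashLift {A B Y : C} (t : Y ⟶ A ⨿ B) (h₁ : t ≫ coprod.desc (𝟙 A) 0 = 0)
    (h₂ : t ≫ coprod.desc 0 (𝟙 B) = 0) : Y ⟶ cosmash A B :=
  kernel.lift (sigma₂ A B) t (by
    ext
    · simpa [sigma₂, coprod.desc_comp, prod.lift_fst, prod.lift_snd] using h₁
    · simpa [sigma₂, coprod.desc_comp, prod.lift_fst, prod.lift_snd] using h₂)

@[simp]
lemma cosmashLift_ι {A B Y : C} (t : Y ⟶ A ⨿ B) (h₁ : t ≫ coprod.desc (𝟙 A) 0 = 0)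
    (h₂ : t ≫ coprod.desc 0 (𝟙 B) = 0) : cosmashLift t h₁ h₂ ≫ cosmashι A B = t :=
  kernel.lift_ι _ _ _

/-- Functoriality of the binary cosmash product: `f ⋄ g` is the restriction of `f + g`. -/
def cosmashMap {A A' B B' : C} (f : A ⟶ A') (g : B ⟶ B') : cosmash A B ⟶ cosmash A' B' :=
  cosmashLift (cosmashι A B ≫ coprod.map f g)
    (by
      have : coprod.map f g ≫ coprod.desc (𝟙 A') (0 : B' ⟶ A') = coprod.desc (𝟙 A) 0 ≫ f := by
        ext <;> simp [coprod.inl_desc, coprod.inr_desc]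
      rw [Category.assoc, this, ← Category.assoc, cosmashι_fst, zero_comp])
    (by
      have : coprod.map f g ≫ coprod.desc (0 : A' ⟶ B') (𝟙 B') = coprod.desc 0 (𝟙 B) ≫ g := by
        ext <;> simp [coprod.inl_desc, coprod.inr_desc]
      rw [Category.assoc, this, ← Category.assoc, cosmashι_snd, zero_comp])

@[simp]
lemma cosmashMap_ι {A A' B B' : C} (f : A ⟶ A') (g : B ⟶ B') :
    cosmashMap f g ≫ cosmashι A' B' = cosmashι A B ≫ coprod.map f g :=
  cosmashLift_ι _ _ _

lemma cosmashMap_id (A B : C) : cosmashMap (𝟙 A) (𝟙 B) = 𝟙 (cosmash A B) := by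
  simp [← cancel_mono (cosmashι A B)]

lemma cosmashMap_comp {A A' A'' B B' B'' : C} (f : A ⟶ A') (f' : A' ⟶ A'') (g : B ⟶ B')
    (g' : B' ⟶ B'') : cosmashMap (f ≫ f') (g ≫ g') = cosmashMap f g ≫ cosmashMap f' g' := by
  rw [← cancel_mono (cosmashι A'' B''), cosmashMap_ι, Category.assoc, cosmashMap_ι,
    ← Category.assoc, cosmashMap_ι, Category.assoc, coprod.map_map]

/-- The comparison morphism `A + B + D ⟶ (A + B) × (A + D) × (B + D)` with matrix
`(ι_A ι_B 0; ι_A 0 ι_D; 0 ι_B ι_D)`. -/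
def sigma₃ (A B D : C) : (A ⨿ B) ⨿ D ⟶ (A ⨿ B) ⨯ ((A ⨿ D) ⨯ (B ⨿ D)) :=
  prod.lift (coprod.desc (coprod.desc coprod.inl coprod.inr) 0)
    (prod.lift (coprod.desc (coprod.desc coprod.inl 0) coprod.inr)
      (coprod.desc (coprod.desc 0 coprod.inl) coprod.inr))

/-- The ternary cosmash product `A ⋄ B ⋄ D`. -/
def cosmash₃ (A B D : C) : C := kernel (sigma₃ A B D)

/-- The inclusion `A ⋄ B ⋄ D ⟶ A + B + D`. -/
def cosmash₃ι (A B D : C) : cosmash₃ A B D ⟶ (A ⨿ B) ⨿ D := kernel.ι (sigma₃ A B D)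

lemma cosmash₃ι_12 (A B D : C) :
    cosmash₃ι A B D ≫ coprod.desc (coprod.desc coprod.inl coprod.inr) 0 =
      (0 : cosmash₃ A B D ⟶ A ⨿ B) := by
  have h : cosmash₃ι A B D ≫ sigma₃ A B D = 0 := kernel.condition _
  have := congrArg (· ≫ prod.fst) h
  simpa only [sigma₃, Category.assoc, prod.lift_fst, zero_comp] using this

lemma cosmash₃ι_13 (A B D : C) :
    cosmash₃ι A B D ≫ coprod.desc (coprod.desc coprod.inl 0) coprod.inr =
      (0 : cosmash₃ A B D ⟶ A ⨿ D) := by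
  have h : cosmash₃ι A B D ≫ sigma₃ A B D = 0 := kernel.condition _
  have := congrArg (· ≫ prod.snd ≫ prod.fst) h
  simpa only [sigma₃, Category.assoc, prod.lift_fst, prod.lift_snd_assoc, zero_comp] using this

lemma cosmash₃ι_23 (A B D : C) :
    cosmash₃ι A B D ≫ coprod.desc (coprod.desc 0 coprod.inl) coprod.inr =
      (0 : cosmash₃ A B D ⟶ B ⨿ D) := by
  have h : cosmash₃ι A B D ≫ sigma₃ A B D = 0 := kernel.condition _
  have := congrArg (· ≫ prod.snd ≫ prod.snd) h
  simpa only [sigma₃, Category.assoc, prod.lift_snd, prod.lift_snd_assoc, zero_comp] using this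

/-- Functoriality of the ternary cosmash product: `f ⋄ g ⋄ l` is the restriction of
`f + g + l`. -/
def cosmash₃Map {A A' B B' D D' : C} (f : A ⟶ A') (g : B ⟶ B') (l : D ⟶ D') :
    cosmash₃ A B D ⟶ cosmash₃ A' B' D' :=
  kernel.lift (sigma₃ A' B' D') (cosmash₃ι A B D ≫ coprod.map (coprod.map f g) l) (by
    have h : coprod.map (coprod.map f g) l ≫ sigma₃ A' B' D' = sigma₃ A B D ≫
        prod.map (coprod.map f g) (prod.map (coprod.map f l) (coprod.map g l)) := by
      ext <;> simp [sigma₃, coprod.inl_desc, coprod.inr_desc, prod.lift_fst, prod.lift_snd]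
    rw [Category.assoc, h, ← Category.assoc,
      show cosmash₃ι A B D ≫ sigma₃ A B D = 0 from kernel.condition _, zero_comp])

@[simp]
lemma cosmash₃Map_ι {A A' B B' D D' : C} (f : A ⟶ A') (g : B ⟶ B') (l : D ⟶ D') :
    cosmash₃Map f g l ≫ cosmash₃ι A' B' D' =
      cosmash₃ι A B D ≫ coprod.map (coprod.map f g) l :=
  kernel.lift_ι _ _ _

/-- The folding morphism on the left `A ⋄ A ⋄ B ⟶ A ⋄ B`, the restriction of
`(1 1) + 1 : A + A + B ⟶ A + B`. -/
def fold₂₁ (A B : C) : cosmash₃ A A B ⟶ cosmash A B :=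
  cosmashLift (cosmash₃ι A A B ≫ coprod.map (coprod.desc (𝟙 A) (𝟙 A)) (𝟙 B))
    (by
      have : coprod.map (coprod.desc (𝟙 A) (𝟙 A)) (𝟙 B) ≫ coprod.desc (𝟙 A) (0 : B ⟶ A) =
          coprod.desc (coprod.desc coprod.inl coprod.inr) 0 ≫ coprod.desc (𝟙 A) (𝟙 A) := by
        ext <;> simp [coprod.inl_desc, coprod.inr_desc]
      rw [Category.assoc, this, ← Category.assoc, cosmash₃ι_12, zero_comp])
    (by
      have : coprod.map (coprod.desc (𝟙 A) (𝟙 A)) (𝟙 B) ≫ coprod.desc (0 : A ⟶ B) (𝟙 B) =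
          coprod.desc (coprod.desc coprod.inl 0) coprod.inr ≫ coprod.desc (0 : A ⟶ B) (𝟙 B) := by
        ext <;> simp [coprod.inl_desc, coprod.inr_desc]
      rw [Category.assoc, this, ← Category.assoc, cosmash₃ι_13, zero_comp])

@[simp]
lemma fold₂₁_ι (A B : C) : fold₂₁ A B ≫ cosmashι A B =
    cosmash₃ι A A B ≫ coprod.map (coprod.desc (𝟙 A) (𝟙 A)) (𝟙 B) :=
  cosmashLift_ι _ _ _

/-- The folding morphism on the right `A ⋄ B ⋄ B ⟶ A ⋄ B`, the restriction of
`1 + (1 1) : A + B + B ⟶ A + B`. -/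
def fold₁₂ (A B : C) : cosmash₃ A B B ⟶ cosmash A B :=
  cosmashLift (cosmash₃ι A B B ≫ coprod.desc (coprod.desc coprod.inl coprod.inr) coprod.inr)
    (by
      have : coprod.desc (coprod.desc coprod.inl coprod.inr) coprod.inr ≫
          coprod.desc (𝟙 A) (0 : B ⟶ A) =
          coprod.desc (coprod.desc coprod.inl coprod.inr) 0 ≫ coprod.desc (𝟙 A) (0 : B ⟶ A) := by
        ext <;> simp [coprod.inl_desc, coprod.inr_desc]
      rw [Category.assoc, this, ← Category.assoc, cosmash₃ι_12, zero_comp])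
    (by
      have : coprod.desc (coprod.desc coprod.inl coprod.inr) coprod.inr ≫
          coprod.desc (0 : A ⟶ B) (𝟙 B) =
          coprod.desc (coprod.desc 0 coprod.inl) coprod.inr ≫ coprod.desc (𝟙 B) (𝟙 B) := by
        ext <;> simp [coprod.inl_desc, coprod.inr_desc]
      rw [Category.assoc, this, ← Category.assoc, cosmash₃ι_23, zero_comp])

@[simp]
lemma fold₁₂_ι (A B : C) : fold₁₂ A B ≫ cosmashι A B =
    cosmash₃ι A B B ≫ coprod.desc (coprod.desc coprod.inl coprod.inr) coprod.inr :=
  cosmashLift_ι _ _ _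

/-! ### Action cores -/

/-- The action core `ψ : A ⋄ X ⟶ X` of a split extension of `A` with kernel object `X`: the unique
morphism whose composite with the kernel is the restriction of `(s k) : A + X ⟶ E`. -/
def SplitExtension.actionCore {A X : C} (S : SplitExtension A X) : cosmash A X ⟶ X :=
  S.isKernel.some.lift (KernelFork.ofι (cosmashι A X ≫ coprod.desc S.s S.k) (by
    rw [Category.assoc, coprod.desc_comp, S.s_p, S.k_p, cosmashι_fst]))

@[simp]
lemma SplitExtension.actionCore_k {A X : C} (S : SplitExtension A X) :
    S.actionCore ≫ S.k = cosmashι A X ≫ coprod.desc S.s S.k :=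
  S.isKernel.some.fac _ WalkingParallelPair.zero

/-- A morphism `A ⋄ X ⟶ X` is an action core if it is associated with a split extension. -/
def IsActionCore {A X : C} (ψ : cosmash A X ⟶ X) : Prop :=
  ∃ S : SplitExtension A X, S.actionCore = ψ

/-- The conjugation action core `A ⋄ A ⟶ A`. -/
def conjCore (A : C) : cosmash A A ⟶ A := cosmashι A A ≫ coprod.desc (𝟙 A) (𝟙 A)

/-! ### Internal crossed modules -/

variable (C) in
/-- Internal crossed modules `(X, A, ψ, ∂)`. -/
structure XMod where
  /-- the domain of the boundary morphism -/
  X : C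
  /-- the codomain of the boundary morphism -/
  A : C
  /-- the action core -/
  ψ : cosmash A X ⟶ X
  /-- the boundary morphism -/
  bd : X ⟶ A
  isActionCore : IsActionCore ψ
  precrossed : ψ ≫ bd = cosmashMap (𝟙 A) bd ≫ conjCore A
  peiffer : cosmashMap bd (𝟙 X) ≫ ψ = conjCore X
  ternary : fold₁₂ A X ≫ ψ = cosmash₃Map (𝟙 A) bd (𝟙 X) ≫ fold₂₁ A X ≫ ψ

/-- A morphism of crossed modules: a commutative square that is equivariant with respect to the
action cores. -/
@[ext]
structure XMod.Hom (M N : XMod C) where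
  /-- the morphism between the domains -/
  fX : M.X ⟶ N.X
  /-- the morphism between the codomains -/
  fA : M.A ⟶ N.A
  comm : M.bd ≫ fA = fX ≫ N.bd
  equivariant : M.ψ ≫ fX = cosmashMap fA fX ≫ N.ψ

instance XMod.instCategory : Category (XMod C) where
  Hom := XMod.Hom
  id M := ⟨𝟙 _, 𝟙 _, by simp, by simp [cosmashMap_id]⟩
  comp a b := ⟨a.fX ≫ b.fX, a.fA ≫ b.fA, by
      rw [← Category.assoc, a.comm, Category.assoc, b.comm, Category.assoc], by
      rw [← Category.assoc, a.equivariant, Category.assoc, b.equivariant, cosmashMap_comp,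
        Category.assoc]⟩
  id_comp a := XMod.Hom.ext (Category.id_comp _) (Category.id_comp _)
  comp_id a := XMod.Hom.ext (Category.comp_id _) (Category.comp_id _)
  assoc a b c := XMod.Hom.ext (Category.assoc _ _ _) (Category.assoc _ _ _)

/-! ### Kernels are crossed modules -/

section Kernel

variable {Y Z B : C} (k : Y ⟶ Z) (q : Z ⟶ B) (w : k ≫ q = 0)
  (hk : Nonempty (IsLimit (KernelFork.ofι k w)))

/-- The split extension `Y ⟶ Z ×_B Z ⇄ Z` for a kernel `k : Y ⟶ Z` of `q : Z ⟶ B`: the middle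
object is the kernel pair of `q`, the split epimorphism is the first projection, its section is the
diagonal, and the kernel is `(0, k)`. -/
def kernelSplitExtension : SplitExtension Z Y where
  E := pullback q q
  k := pullback.lift 0 k (by simp [w])
  p := pullback.fst q q
  s := pullback.lift (𝟙 Z) (𝟙 Z) rfl
  s_p := pullback.lift_fst _ _ _
  k_p := pullback.lift_fst _ _ _
  isKernel := by
    have : Mono k := mono_of_isLimit_fork hk.some
    have hm : Mono (pullback.lift (0 : Y ⟶ Z) k (by simp [w]) : Y ⟶ pullback q q) :=
      mono_of_mono_fac (pullback.lift_snd _ _ _)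
    refine ⟨KernelFork.IsLimit.ofι' _ _ fun t ht =>
      ⟨hk.some.lift (KernelFork.ofι (t ≫ pullback.snd q q) (by
        rw [Category.assoc, ← pullback.condition, ← Category.assoc, ht, zero_comp])), ?_⟩⟩
    have hfac := hk.some.fac (KernelFork.ofι (t ≫ pullback.snd q q) (by
      rw [Category.assoc, ← pullback.condition, ← Category.assoc, ht, zero_comp]))
      WalkingParallelPair.zero
    apply pullback.hom_ext
    · simp [ht, pullback.lift_fst]
    · simpa [pullback.lift_snd] using hfac

/-- The conjugation action core `Z ⋄ Y ⟶ Y` of a kernel `k : Y ⟶ Z`. -/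
def kernelCore : cosmash Z Y ⟶ Y := (kernelSplitExtension k q w hk).actionCore

/-- The conjugation action core of a kernel `k` is the restriction of the conjugation of `Z` on
itself; as `k` is a monomorphism, this determines it. -/
lemma kernelCore_comp :
    kernelCore k q w hk ≫ k = cosmashMap (𝟙 Z) k ≫ conjCore Z := by
  have h := congrArg (· ≫ pullback.snd q q) (kernelSplitExtension k q w hk).actionCore_k
  have h' : kernelCore k q w hk ≫ k = cosmashι Z Y ≫ coprod.desc (𝟙 Z) k := by
    simpa [kernelCore, kernelSplitExtension, coprod.desc_comp, pullback.lift_snd] using h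
  rw [h', conjCore, ← Category.assoc, cosmashMap_ι]
  simp

/-- A kernel `k : Y ⟶ Z`, endowed with its conjugation action core, is a crossed module. -/
def XMod.ofKernel : XMod C where
  X := Y
  A := Z
  ψ := kernelCore k q w hk
  bd := k
  isActionCore := ⟨_, rfl⟩
  precrossed := kernelCore_comp k q w hk
  peiffer := by
    have : Mono k := mono_of_isLimit_fork hk.some
    rw [← cancel_mono k, Category.assoc, kernelCore_comp, conjCore, conjCore, Category.assoc,
      ← Category.assoc (cosmashMap (𝟙 Z) k), cosmashMap_ι, Category.assoc,
      ← Category.assoc, cosmashMap_ι, Category.assoc]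
    congr 1
    ext <;> simp [coprod.inl_desc, coprod.inr_desc]
  ternary := by
    have : Mono k := mono_of_isLimit_fork hk.some
    rw [← cancel_mono k]
    simp only [Category.assoc, kernelCore_comp, conjCore]
    rw [← Category.assoc (cosmashMap (𝟙 Z) k), cosmashMap_ι]
    simp only [Category.assoc]
    rw [← Category.assoc (fold₁₂ _ _), fold₁₂_ι, ← Category.assoc (fold₂₁ _ _), fold₂₁_ι]
    simp only [Category.assoc]
    rw [← Category.assoc (cosmash₃Map _ _ _), cosmash₃Map_ι]
    simp only [Category.assoc]
    congr 1
    ext <;> simp [coprod.inl_desc, coprod.inr_desc]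

end Kernel

/-- The crossed module given by the kernel of a split extension, with its conjugation action
core. -/
def SplitExtension.toXMod {B X : C} (S : SplitExtension B X) : XMod C :=
  XMod.ofKernel S.k S.p S.k_p S.isKernel

end

end SemiAb

/-!
Let `S = (Q ⟶ Z ⇄ P)` be the given split extension, `e : M ⟶ N` a regular epimorphism of crossed
modules and `f` a morphism from the crossed module `Q ⟶ Z` to `N`. Write `E_M` and `E_N` for the
middle objects of the split extensions that carry the actions of `M` and `N`, the semidirect
products `M.X ⋊ M.A` and `N.X ⋊ N.A`.

An equivariant pair of morphisms extends to the middle objects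
(`SplitExtension.exists_hom_of_equivariant`), so `e` induces `E_M ⟶ E_N`, and `f`, restricted along
the section to an action of `P`, induces `γ : Z ⟶ E_N`. As `P` is projective and `e` is regular
epic on codomains, `P ⟶ Z ⟶ N.A` lifts to `t : P ⟶ M.A`. The comparison `E_M ⟶ E_N ×_{N.A} M.A` is
a strong epimorphism (`strongEpi_pullback_lift`), and its base change along the morphism
`Z ⟶ E_N ×_{N.A} M.A` with components `γ` and `Z ⟶ P ⟶ M.A` is a regular epimorphism onto `S` in
the category of split extensions over `P`. It splits because `S` is projective, which yields
`γ' : Z ⟶ E_M` above `γ` and `t`. The lifting of `f` has as components the restriction `φ : Q ⟶ M.X`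
of `γ'` to the kernels and the composite `u` of `γ'` with the codomain morphism `E_M ⟶ M.A` of the
reflexive graph of `M`, which exists by the precrossed module condition.

Equivariance of `(φ, u)` for the action of `P` holds by construction. Equivariance for the
conjugation action of `Z` follows (`SplitExtension.equivariant_of_equivariant_s`), because `Z ⋄ Q`
is covered by `P ⋄ Q`, `Q ⋄ Q` and `P ⋄ Q ⋄ Q` (`cosmash_coprod_hom_ext`): on the second the Peiffer
condition applies, on the third the ternary condition.

The remaining point is that a regular epimorphism `e` of crossed modules is a regular epimorphism in
both components. On codomains this holds since `M ↦ M.A` has a right adjoint. On domains, the image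
of `M.X` in `N.X` carries a crossed module through which `e` factors (`XMod.strongEpi_fX`); its
action comes from the image of `E_M` in `E_N`, by `SplitExtension.strongEpi_kernel`: a strong
epimorphism between middle objects of split extensions restricts to one between kernel objects.

All this rests on protomodularity in the form that the kernel and the section of a split extension
are jointly extremal epic (`SplitExtension.isIso_of_mono`). Strong and regular epimorphisms coincide
in a regular category; the former are used throughout for their cancellation properties.
-/

namespace SemiAb

noncomputable section

attribute [local simp] pullback.lift_fst pullback.lift_snd pullback.lift_fst_assoc
  pullback.lift_snd_assoc coprod.inl_desc coprod.inr_desc coprod.inl_desc_assoc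
  coprod.inr_desc_assoc

variable {C : Type u} [Category.{v} C]

/-! ### Strong epimorphisms in regular categories -/

lemma strongEpi_of_forall_mono [Regular C] {X Y : C} (f : X ⟶ Y)
    (h : ∀ ⦃J : C⦄ (i : X ⟶ J) (m : J ⟶ Y), Mono m → i ≫ m = f → IsIso m) : StrongEpi f :=
  (extremalEpi_iff_strongEpi_of_hasPullbacks f).1
    (ExtremalEpi.mk_of_hasEqualizers f fun _ i m hf _ => h i m inferInstance hf)

lemma isRegularEpi_of_strongEpi [Regular C] {X Y : C} (f : X ⟶ Y) [StrongEpi f] :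
    IsRegularEpi f :=
  inferInstance

instance strongEpi_coprodMap [Regular C] [HasBinaryCoproducts C] {A A' B B' : C} (f : A ⟶ A')
    (g : B ⟶ B') [StrongEpi f] [StrongEpi g] : StrongEpi (coprod.map f g) := by
  refine strongEpi_of_forall_mono _ fun J i m _ h => ?_
  have sq₁ : CommSq (coprod.inl ≫ i) f m coprod.inl := ⟨by simp [h]⟩
  have sq₂ : CommSq (coprod.inr ≫ i) g m coprod.inr := ⟨by simp [h]⟩
  have : IsSplitEpi m := ⟨⟨coprod.desc sq₁.lift sq₂.lift, by ext <;> simp⟩⟩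
  exact isIso_of_mono_of_isSplitEpi m

instance strongEpi_pullback_snd [Regular C] {X Y Z : C} (f : X ⟶ Z) (g : Y ⟶ Z) [StrongEpi f] :
    StrongEpi (pullback.snd f g) := by
  have := isRegularEpi_of_strongEpi f
  infer_instance

instance strongEpi_pullback_fst [Regular C] {X Y Z : C} (f : X ⟶ Z) (g : Y ⟶ Z) [StrongEpi g] :
    StrongEpi (pullback.fst f g) := by
  have := isRegularEpi_of_strongEpi g
  infer_instance

lemma left_comp_eq_right_comp [Regular C] {E Q W : C} (q : E ⟶ Q) [IsRegularEpi q] (u : E ⟶ W)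
    (h : pullback.fst q q ≫ u = pullback.snd q q ≫ u) :
    IsRegularEpi.left q ≫ u = IsRegularEpi.right q ≫ u := by
  simpa using congrArg (pullback.lift _ _ (IsRegularEpi.w q) ≫ ·) h

/-! ### Split extensions and protomodularity -/

namespace SplitExtension

section

variable [HasZeroMorphisms C] {B X : C} (S : SplitExtension B X)

instance mono_k : Mono S.k := mono_of_isLimit_fork S.isKernel.some

/-- The factorization through the kernel object of a morphism that `p` sends to zero. -/
def lift {T : C} (t : T ⟶ S.E) (h : t ≫ S.p = 0) : T ⟶ X :=
  S.isKernel.some.lift (KernelFork.ofι t h)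

@[simp]
lemma lift_k {T : C} (t : T ⟶ S.E) (h : t ≫ S.p = 0) : S.lift t h ≫ S.k = t :=
  S.isKernel.some.fac _ WalkingParallelPair.zero

@[simp]
lemma lift_k_assoc {T W : C} (t : T ⟶ S.E) (h : t ≫ S.p = 0) (u : S.E ⟶ W) :
    S.lift t h ≫ S.k ≫ u = t ≫ u := by
  rw [← Category.assoc, lift_k]

/-- A split epimorphism `p` with a chosen section `s`, as a split extension with kernel object the
chosen kernel of `p`. -/
def ofPoint {E B : C} (p : E ⟶ B) [HasKernel p] (s : B ⟶ E) (h : s ≫ p = 𝟙 B) :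
    SplitExtension B (kernel p) where
  E := E
  k := kernel.ι p
  p := p
  s := s
  s_p := h
  k_p := kernel.condition p
  isKernel := ⟨kernelIsKernel p⟩

end

variable [HasZeroMorphisms C] [SemiAbelian C] {B X : C} (S : SplitExtension B X)

/-- The kernel and the section of a split extension are jointly extremal epic. -/
lemma isIso_of_mono {J : C} (m : J ⟶ S.E) [hm : Mono m] (a : X ⟶ J) (b : B ⟶ J)
    (ha : a ≫ m = S.k) (hb : b ≫ m = S.s) : IsIso m := by
  have hk : a ≫ m ≫ S.p = 0 := by rw [← Category.assoc, ha, S.k_p]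
  have : Mono a := mono_of_mono_fac ha
  let T : SplitExtension B X :=
    { E := J
      k := a
      p := m ≫ S.p
      s := b
      s_p := by rw [← Category.assoc, hb, S.s_p]
      k_p := hk
      isKernel := ⟨KernelFork.IsLimit.ofι' _ _ fun t ht =>
        ⟨S.lift (t ≫ m) (by simpa using ht), by simp [← cancel_mono m, ha]⟩⟩ }
  exact SemiAbelian.splitShortFive T S (𝟙 X) m (𝟙 B) (by simp [T, ha]) (by simp [T])
    (by simp [T, hb]) inferInstance inferInstance

/-- The special case of `SplitExtension.isIso_of_mono` for a split epimorphism and its chosen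
kernel. -/
lemma isIso_of_mono_of_point {E B J : C} (p : E ⟶ B) (s : B ⟶ E) (h : s ≫ p = 𝟙 B) (m : J ⟶ E)
    [hm : Mono m] (a : kernel p ⟶ J) (b : B ⟶ J) (ha : a ≫ m = kernel.ι p) (hb : b ≫ m = s) :
    IsIso m :=
  (ofPoint p s h).isIso_of_mono m (hm := hm) a b ha hb

lemma hom_ext {W : C} {u w : S.E ⟶ W} (hk : S.k ≫ u = S.k ≫ w) (hs : S.s ≫ u = S.s ≫ w) :
    u = w := by
  have := S.isIso_of_mono (equalizer.ι u w) (equalizer.lift _ hk) (equalizer.lift _ hs)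
    (by simp) (by simp)
  rw [← cancel_epi (equalizer.ι u w), equalizer.condition]

/-- The special case of `SplitExtension.hom_ext` for a split epimorphism and its chosen kernel. -/
lemma hom_ext_of_point {E B W : C} (p : E ⟶ B) (s : B ⟶ E) (h : s ≫ p = 𝟙 B) {u w : E ⟶ W}
    (hk : kernel.ι p ≫ u = kernel.ι p ≫ w) (hs : s ≫ u = s ≫ w) : u = w :=
  (ofPoint p s h).hom_ext hk hs

instance strongEpi_desc : StrongEpi (coprod.desc S.s S.k) :=
  strongEpi_of_forall_mono _ fun _ i m _ h =>
    S.isIso_of_mono m (coprod.inr ≫ i) (coprod.inl ≫ i) (by simp [h]) (by simp [h])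

end SplitExtension

variable [HasZeroMorphisms C] [SemiAbelian C]

/-- In the pullback of a split epimorphism along a split epimorphism, the two inclusions induced by
the sections are jointly extremal epic. This is the Mal'tsev property of protomodular
categories. -/
lemma isIso_of_mono_pullback {E B D J : C} {p : E ⟶ B} {s : B ⟶ E} {q : D ⟶ B} {r : B ⟶ D}
    (hs : s ≫ p = 𝟙 B) (hr : r ≫ q = 𝟙 B) (m : J ⟶ pullback p q) [Mono m]
    (a : E ⟶ J) (b : D ⟶ J)
    (ha : a ≫ m = pullback.lift (𝟙 E) (p ≫ r) (by simp [hr]))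
    (hb : b ≫ m = pullback.lift (q ≫ s) (𝟙 D) (by simp [hs])) : IsIso m := by
  refine SplitExtension.isIso_of_mono_of_point (pullback.snd p q)
    (pullback.lift (q ≫ s) (𝟙 D) (by simp [hs])) (by simp) m
    (kernel.ι (pullback.snd p q) ≫ pullback.fst p q ≫ a) b ?_ hb
  apply pullback.hom_ext
  · simp [ha]
  · simp only [Category.assoc, ha, pullback.lift_snd, kernel.condition]
    rw [← Category.assoc (pullback.fst p q), pullback.condition, Category.assoc,
      kernel.condition_assoc, zero_comp]

/-- A strong epimorphism of split epimorphisms induces a strong epimorphism onto the pullback: with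
`g x = y` and `l (p' x) = l a`, the pair `(y, a)` is obtained from the pairs `(g x, p' x)`,
`(g (s' (p' x)), p' x)` and `(g (s' a), a)` in the image by a Mal'tsev operation. -/
lemma strongEpi_pullback_lift {E B E' B' : C} {p : E ⟶ B} {s : B ⟶ E} {p' : E' ⟶ B'}
    {s' : B' ⟶ E'} {g : E' ⟶ E} {l : B' ⟶ B} (hs' : s' ≫ p' = 𝟙 B') (hp : g ≫ p = p' ≫ l)
    (hs : s' ≫ g = l ≫ s) [StrongEpi g] : StrongEpi (pullback.lift g p' hp) := by
  refine strongEpi_of_forall_mono _ fun J i m _ h => ?_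
  -- `w` sends `(x, a)` with `l (p' x) = l a` to `(g x, a)`. It is a strong epimorphism, as a base
  -- change of `g`, so it suffices that it factors through `m`.
  let W := pullback p' (pullback.fst l l)
  let w : W ⟶ pullback p l := pullback.lift (pullback.fst _ _ ≫ g)
    (pullback.snd _ _ ≫ pullback.snd l l) (by
      rw [Category.assoc, hp, ← Category.assoc, pullback.condition, Category.assoc,
        pullback.condition, Category.assoc])
  let w' : pullback g (pullback.fst p l) ⟶ W := pullback.lift (pullback.fst _ _)
    (pullback.lift (pullback.fst _ _ ≫ p') (pullback.snd _ _ ≫ pullback.snd p l) (by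
      rw [Category.assoc, ← hp, ← Category.assoc, pullback.condition, Category.assoc,
        pullback.condition, Category.assoc])) (by simp)
  have hw : w' ≫ w = pullback.snd g (pullback.fst p l) := by
    apply pullback.hom_ext
    · simp [w', w, pullback.condition]
    · simp [w', w]
  have : StrongEpi (w' ≫ w) := by rw [hw]; infer_instance
  have : StrongEpi w := strongEpi_of_strongEpi w' w
  have hi₁ : i ≫ m ≫ pullback.fst p l = g := by rw [← Category.assoc, h]; simp
  have hi₂ : i ≫ m ≫ pullback.snd p l = p' := by rw [← Category.assoc, h]; simp
  -- `W` is a pullback of points, with inclusions `x ↦ (x, p' x)` and `(a', a) ↦ (s' a', a)`; both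
  -- are sent by `w` into the image of `g` and `p'`, hence into `J`.
  have : IsIso (pullback.snd m w) := by
    refine isIso_of_mono_pullback (s := s') (r := pullback.lift (𝟙 _) (𝟙 _) rfl) hs' (by simp) _
      (pullback.lift i (pullback.lift (𝟙 _) (p' ≫ pullback.lift (𝟙 _) (𝟙 _) rfl) (by simp)) ?_)
      (pullback.lift (pullback.snd l l ≫ s' ≫ i)
        (pullback.lift (pullback.fst l l ≫ s') (𝟙 _) (by simp [hs'])) ?_)
      (pullback.lift_snd _ _ _) (pullback.lift_snd _ _ _)
    · apply pullback.hom_ext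
      · simp [w, hi₁]
      · simp [w, hi₂]
    · apply pullback.hom_ext
      · simp only [w, Category.assoc, hi₁, pullback.lift_fst, pullback.lift_fst_assoc]
        rw [hs, ← Category.assoc, ← Category.assoc, pullback.condition]
      · simp [w, hi₂, hs']
  have hm : (inv (pullback.snd m w) ≫ pullback.fst m w) ≫ m = w := by
    rw [Category.assoc, pullback.condition, IsIso.inv_hom_id_assoc]
  have : StrongEpi ((inv (pullback.snd m w) ≫ pullback.fst m w) ≫ m) := by rw [hm]; infer_instance
  have : StrongEpi m := strongEpi_of_strongEpi (inv (pullback.snd m w) ≫ pullback.fst m w) m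
  exact isIso_of_mono_of_strongEpi m

namespace SplitExtension

variable {B X B' X' : C} (S : SplitExtension B X) (S' : SplitExtension B' X')

/-- A strong epimorphism between the middle objects of split extensions restricts to a strong
epimorphism between the kernel objects. -/
lemma strongEpi_kernel {f : X' ⟶ X} {g : S'.E ⟶ S.E} {l : B' ⟶ B} (hk : S'.k ≫ g = f ≫ S.k)
    (hp : g ≫ S.p = S'.p ≫ l) (hs : S'.s ≫ g = l ≫ S.s) [hg : StrongEpi g] : StrongEpi f := by
  have := strongEpi_pullback_lift S'.s_p hp hs
  let z : X ⟶ pullback S.p l := pullback.lift S.k 0 (by simp [S.k_p])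
  have hc := pullback.condition (f := pullback.lift g S'.p hp) (g := z)
  have h₁ := congrArg (· ≫ pullback.fst S.p l) hc
  have h₂ := congrArg (· ≫ pullback.snd S.p l) hc
  simp only [Category.assoc, pullback.lift_fst, pullback.lift_snd, comp_zero, z] at h₁ h₂
  have h : S'.lift _ h₂ ≫ f = pullback.snd (pullback.lift g S'.p hp) z := by
    rw [← cancel_mono S.k, Category.assoc, ← hk, lift_k_assoc, h₁]
  have : StrongEpi (S'.lift _ h₂ ≫ f) := by rw [h]; infer_instance
  exact strongEpi_of_strongEpi (S'.lift _ h₂) f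

lemma strongEpi_middle {f : X' ⟶ X} {g : S'.E ⟶ S.E} {l : B' ⟶ B} (hk : S'.k ≫ g = f ≫ S.k)
    (hs : S'.s ≫ g = l ≫ S.s) [StrongEpi f] [StrongEpi l] : StrongEpi g := by
  have h : coprod.desc S'.s S'.k ≫ g = coprod.map l f ≫ coprod.desc S.s S.k := by
    ext <;> simp [hk, hs]
  have : StrongEpi (coprod.desc S'.s S'.k ≫ g) := by rw [h]; infer_instance
  exact strongEpi_of_strongEpi (coprod.desc S'.s S'.k) g

end SplitExtension

/-- A strong epimorphism is a cokernel of its kernel: the two composites of its kernel pair with `u`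
agree on the diagonal, and on the kernel of the first projection if `u` vanishes on the kernel. -/
lemma exists_desc_of_strongEpi {E Q W : C} (q : E ⟶ Q) [StrongEpi q] (u : E ⟶ W)
    (h : kernel.ι q ≫ u = 0) : ∃ w : Q ⟶ W, q ≫ w = u := by
  have := isRegularEpi_of_strongEpi q
  have hq : (kernel.ι (pullback.fst q q) ≫ pullback.snd q q) ≫ q = 0 := by
    rw [Category.assoc, ← pullback.condition, kernel.condition_assoc, zero_comp]
  have hu : pullback.fst q q ≫ u = pullback.snd q q ≫ u := by
    refine SplitExtension.hom_ext_of_point (pullback.fst q q)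
      (pullback.lift (𝟙 E) (𝟙 E) rfl) (by simp) ?_ (by simp)
    rw [kernel.condition_assoc, zero_comp, ← Category.assoc, ← kernel.lift_ι q _ hq,
      Category.assoc, h, comp_zero]
  exact ⟨IsRegularEpi.desc q u (left_comp_eq_right_comp q u hu), IsRegularEpi.fac q u _⟩

/-! ### Cosmash products -/

/-- The split extension of `A` given by `A + B ⟶ A` and the coproduct inclusion. Its kernel object
is usually written `A ♭ B`. -/
def coprodExtension (A B : C) : SplitExtension A (kernel (coprod.desc (𝟙 A) (0 : B ⟶ A))) :=
  SplitExtension.ofPoint (coprod.desc (𝟙 A) 0) coprod.inl (by simp)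

/-- The split extension `A ⋄ B ⟶ A ♭ B ⇄ B`. -/
def flatExtension (A B : C) : SplitExtension B (cosmash A B) where
  E := kernel (coprod.desc (𝟙 A) (0 : B ⟶ A))
  k := kernel.lift _ (cosmashι A B) (cosmashι_fst A B)
  p := kernel.ι _ ≫ coprod.desc 0 (𝟙 B)
  s := kernel.lift _ coprod.inr (by simp)
  s_p := by simp
  k_p := by simp [cosmashι_snd]
  isKernel := by
    have : Mono (kernel.lift _ (cosmashι A B) (cosmashι_fst A B)) :=
      mono_of_mono_fac (kernel.lift_ι _ _ _)
    exact ⟨KernelFork.IsLimit.ofι' _ _ fun t ht =>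
      ⟨cosmashLift (t ≫ kernel.ι _) (by simp) (by simpa using ht), by
        simp [← cancel_mono (kernel.ι (coprod.desc (𝟙 A) (0 : B ⟶ A)))]⟩⟩

/-- Two morphisms out of `A ♭ B` are equal when they agree on `A ⋄ B` and on `B`. -/
lemma flat_hom_ext {A B W : C} {u w : kernel (coprod.desc (𝟙 A) (0 : B ⟶ A)) ⟶ W}
    (hk : kernel.lift _ (cosmashι A B) (cosmashι_fst A B) ≫ u =
      kernel.lift _ (cosmashι A B) (cosmashι_fst A B) ≫ w)
    (hs : kernel.lift (coprod.desc (𝟙 A) (0 : B ⟶ A)) coprod.inr (by simp) ≫ u =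
      kernel.lift _ coprod.inr (by simp) ≫ w) : u = w :=
  (flatExtension A B).hom_ext hk hs

instance strongEpi_cosmashMap {A A' B B' : C} (f : A ⟶ A') (g : B ⟶ B') [StrongEpi f]
    [StrongEpi g] : StrongEpi (cosmashMap f g) := by
  have hmap : coprod.map f g ≫ coprod.desc (𝟙 A') (0 : B' ⟶ A') = coprod.desc (𝟙 A) 0 ≫ f := by
    ext <;> simp
  have h : (kernel.ι (coprod.desc (𝟙 A) (0 : B ⟶ A)) ≫ coprod.map f g) ≫
      coprod.desc (𝟙 A') (0 : B' ⟶ A') = 0 := by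
    rw [Category.assoc, hmap, kernel.condition_assoc, zero_comp]
  have h₁ : StrongEpi (kernel.lift _ _ h) :=
    SplitExtension.strongEpi_kernel (coprodExtension A' B') (coprodExtension A B)
      (g := coprod.map f g) (l := f) (kernel.lift_ι _ _ h).symm
      hmap (coprod.inl_map f g)
      (hg := inferInstanceAs (StrongEpi (coprod.map f g)))
  have hk : kernel.lift _ (cosmashι A B) (cosmashι_fst A B) ≫ kernel.lift _ _ h =
      cosmashMap f g ≫ kernel.lift _ (cosmashι A' B') (cosmashι_fst A' B') := by
    simp [← cancel_mono (kernel.ι (coprod.desc (𝟙 A') (0 : B' ⟶ A')))]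
  have hp : kernel.lift _ _ h ≫ kernel.ι _ ≫ coprod.desc 0 (𝟙 B') =
      (kernel.ι (coprod.desc (𝟙 A) 0) ≫ coprod.desc 0 (𝟙 B)) ≫ g := by
    have : coprod.map f g ≫ coprod.desc (0 : A' ⟶ B') (𝟙 B') = coprod.desc 0 (𝟙 B) ≫ g := by
      ext <;> simp
    simp only [kernel.lift_ι_assoc, Category.assoc, this]
  have hs : kernel.lift (coprod.desc (𝟙 A) (0 : B ⟶ A)) coprod.inr (by simp) ≫
      kernel.lift _ _ h = g ≫ kernel.lift _ coprod.inr (by simp) := by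
    simp [← cancel_mono (kernel.ι (coprod.desc (𝟙 A') (0 : B' ⟶ A')))]
  exact SplitExtension.strongEpi_kernel (flatExtension A' B') (flatExtension A B)
    (g := kernel.lift _ _ h) (l := g) hk hp hs (hg := h₁)

/-! ### Equivariant morphisms -/

/-- A pair of morphisms that is equivariant for the action cores of two split extensions extends to
the middle objects: `E` is the quotient of `A + X` by the kernel of `A ♭ X ⟶ X`, and the latter is
determined by the action core. -/
lemma SplitExtension.exists_hom_of_equivariant {A X A' X' : C} (S : SplitExtension A X)
    (S' : SplitExtension A' X') {f : X ⟶ X'} {l : A ⟶ A'}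
    (h : S.actionCore ≫ f = cosmashMap l f ≫ S'.actionCore) :
    ∃ g : S.E ⟶ S'.E, S.k ≫ g = f ≫ S'.k ∧ S.s ≫ g = l ≫ S'.s ∧ g ≫ S'.p = S.p ≫ l := by
  have hp : coprod.desc S.s S.k ≫ S.p = coprod.desc (𝟙 A) 0 := by
    ext <;> simp [S.s_p, S.k_p]
  -- `ξ` is the action of the monad `A ♭ -`, which restricts to the action core and splits the unit.
  let ξ : kernel (coprod.desc (𝟙 A) (0 : X ⟶ A)) ⟶ X :=
    S.lift (kernel.ι _ ≫ coprod.desc S.s S.k) (by rw [Category.assoc, hp, kernel.condition])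
  have hξ : ξ ≫ f ≫ S'.k =
      kernel.ι _ ≫ coprod.map l f ≫ coprod.desc S'.s S'.k := by
    apply flat_hom_ext
    · have hξ' : kernel.lift _ (cosmashι A X) (cosmashι_fst A X) ≫ ξ = S.actionCore := by
        simp [← cancel_mono S.k, ξ]
      rw [← Category.assoc, hξ', ← Category.assoc, h, Category.assoc, S'.actionCore_k,
        ← Category.assoc, cosmashMap_ι, kernel.lift_ι_assoc, Category.assoc]
    · have hξ' : kernel.lift _ coprod.inr (by simp) ≫ ξ = 𝟙 X := by
        simp [← cancel_mono S.k, ξ]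
      rw [← Category.assoc, hξ', kernel.lift_ι_assoc]
      simp
  -- The kernel of `A + X ⟶ E` lies in `A ♭ X`, where it is the kernel of `ξ`.
  have hκ : kernel.ι (coprod.desc S.s S.k) ≫ coprod.desc (𝟙 A) (0 : X ⟶ A) = 0 := by
    rw [← hp, kernel.condition_assoc, zero_comp]
  have hκξ : kernel.lift _ _ hκ ≫ ξ = 0 := by
    simp [← cancel_mono S.k, ξ]
  obtain ⟨g, hg⟩ := exists_desc_of_strongEpi (coprod.desc S.s S.k)
    (coprod.map l f ≫ coprod.desc S'.s S'.k) (by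
      rw [← kernel.lift_ι _ _ hκ, Category.assoc, ← hξ, ← Category.assoc, hκξ, zero_comp])
  have hk : S.k ≫ g = f ≫ S'.k := by simpa using congrArg (coprod.inr ≫ ·) hg
  have hs : S.s ≫ g = l ≫ S'.s := by simpa using congrArg (coprod.inl ≫ ·) hg
  refine ⟨g, hk, hs, S.hom_ext ?_ ?_⟩
  · rw [← Category.assoc, hk, Category.assoc, S'.k_p, ← Category.assoc, S.k_p, comp_zero, zero_comp]
  · rw [← Category.assoc, hs, Category.assoc, S'.s_p, ← Category.assoc, S.s_p, Category.comp_id,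
      Category.id_comp]

/-! ### The cosmash product with a coproduct -/

lemma cosmashMap_zero_left {A A' B B' : C} (g : B ⟶ B') :
    cosmashMap (0 : A ⟶ A') g = 0 := by
  have : coprod.map (0 : A ⟶ A') g = coprod.desc 0 (𝟙 B) ≫ g ≫ coprod.inr := by ext <;> simp
  rw [← cancel_mono (cosmashι A' B'), cosmashMap_ι, this, ← Category.assoc, cosmashι_snd, zero_comp,
    zero_comp]

/-- The inclusion `A ⋄ B ⋄ D ⟶ (A + B) ⋄ D`. -/
def cosmash₃Incl (A B D : C) : cosmash₃ A B D ⟶ cosmash (A ⨿ B) D :=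
  cosmashLift (cosmash₃ι A B D)
    (by
      have : coprod.desc (𝟙 (A ⨿ B)) (0 : D ⟶ A ⨿ B) =
          coprod.desc (coprod.desc coprod.inl coprod.inr) 0 := by
        ext <;> simp
      rw [this, cosmash₃ι_12])
    (by
      have : coprod.desc (0 : A ⨿ B ⟶ D) (𝟙 D) =
          coprod.desc (coprod.desc coprod.inl 0) coprod.inr ≫ coprod.desc (0 : A ⟶ D) (𝟙 D) := by
        ext <;> simp
      rw [this, ← Category.assoc, cosmash₃ι_13, zero_comp])

@[simp]
lemma cosmash₃Incl_ι (A B D : C) : cosmash₃Incl A B D ≫ cosmashι (A ⨿ B) D = cosmash₃ι A B D :=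
  cosmashLift_ι _ _ _

/-- Two morphisms out of `(A + B) ⋄ D` are equal when they agree on `A ⋄ D`, on `B ⋄ D` and on
`A ⋄ B ⋄ D`: the object `A ⋄ B ⋄ D` is the kernel of a split epimorphism onto `B ⋄ D` whose domain
is the kernel of the split epimorphism `(A + B) ⋄ D ⟶ A ⋄ D`. -/
lemma cosmash_coprod_hom_ext {A B D W : C} {u w : cosmash (A ⨿ B) D ⟶ W}
    (h₁ : cosmashMap coprod.inl (𝟙 D) ≫ u = cosmashMap coprod.inl (𝟙 D) ≫ w)
    (h₂ : cosmashMap coprod.inr (𝟙 D) ≫ u = cosmashMap coprod.inr (𝟙 D) ≫ w)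
    (h₃ : cosmash₃Incl A B D ≫ u = cosmash₃Incl A B D ≫ w) : u = w := by
  let p₁ : cosmash (A ⨿ B) D ⟶ cosmash A D := cosmashMap (coprod.desc (𝟙 A) 0) (𝟙 D)
  let p₂ : cosmash (A ⨿ B) D ⟶ cosmash B D := cosmashMap (coprod.desc 0 (𝟙 B)) (𝟙 D)
  have hs₁ : cosmashMap coprod.inl (𝟙 D) ≫ p₁ = 𝟙 _ := by
    simp [p₁, ← cosmashMap_comp, cosmashMap_id]
  have hs₂ : cosmashMap coprod.inr (𝟙 D) ≫ p₁ = 0 := by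
    simp [p₁, ← cosmashMap_comp, cosmashMap_zero_left]
  have hs₂' : cosmashMap coprod.inr (𝟙 D) ≫ p₂ = 𝟙 _ := by
    simp [p₂, ← cosmashMap_comp, cosmashMap_id]
  refine SplitExtension.hom_ext_of_point p₁ _ hs₁ ?_ h₁
  refine SplitExtension.hom_ext_of_point (kernel.ι p₁ ≫ p₂) (kernel.lift p₁ _ hs₂)
    (by simpa using hs₂') ?_ (by simpa using h₂)
  -- The kernel `κ` of both retractions is annihilated by the three components of `sigma₃`.
  obtain ⟨κ, κ_def⟩ : ∃ κ : kernel (kernel.ι p₁ ≫ p₂) ⟶ cosmash (A ⨿ B) D,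
    κ = kernel.ι _ ≫ kernel.ι p₁ := ⟨_, rfl⟩
  have hκ₁ : κ ≫ p₁ = 0 := by simp [κ_def]
  have hκ₂ : κ ≫ p₂ = 0 := by simp [κ_def]
  have h12 : κ ≫ cosmashι _ _ ≫ coprod.desc (coprod.desc coprod.inl coprod.inr) 0 =
      (0 : _ ⟶ A ⨿ B) := by
    have : coprod.desc (coprod.desc coprod.inl coprod.inr) 0 =
        coprod.desc (𝟙 (A ⨿ B)) (0 : D ⟶ A ⨿ B) := by
      ext <;> simp
    rw [this, cosmashι_fst, comp_zero]
  have h13 : κ ≫ cosmashι _ _ ≫ coprod.desc (coprod.desc coprod.inl 0) coprod.inr =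
      (0 : _ ⟶ A ⨿ D) := by
    have : coprod.desc (coprod.desc (coprod.inl : A ⟶ A ⨿ D) (0 : B ⟶ A ⨿ D)) coprod.inr =
        coprod.map (coprod.desc (𝟙 A) 0) (𝟙 D) := by
      ext <;> simp
    rw [this, ← cosmashMap_ι, ← Category.assoc, hκ₁, zero_comp]
  have h23 : κ ≫ cosmashι _ _ ≫ coprod.desc (coprod.desc 0 coprod.inl) coprod.inr =
      (0 : _ ⟶ B ⨿ D) := by
    have : coprod.desc (coprod.desc (0 : A ⟶ B ⨿ D) (coprod.inl : B ⟶ B ⨿ D)) coprod.inr =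
        coprod.map (coprod.desc 0 (𝟙 B)) (𝟙 D) := by
      ext <;> simp
    rw [this, ← cosmashMap_ι, ← Category.assoc, hκ₂, zero_comp]
  have hσ : (κ ≫ cosmashι _ _) ≫ sigma₃ A B D = 0 := by
    rw [sigma₃, Category.assoc, prod.comp_lift, prod.comp_lift, prod.comp_lift, prod.comp_lift]
    simp only [h12, h13, h23]
    ext <;> simp [prod.lift_fst, prod.lift_snd]
  obtain ⟨j, hj⟩ : ∃ j : _ ⟶ cosmash₃ A B D, j ≫ cosmash₃ι A B D = κ ≫ cosmashι _ _ :=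
    ⟨kernel.lift _ _ hσ, kernel.lift_ι _ _ hσ⟩
  have hκ : κ = j ≫ cosmash₃Incl A B D := by
    rw [← cancel_mono (cosmashι (A ⨿ B) D), Category.assoc, cosmash₃Incl_ι, hj]
  rw [← Category.assoc, ← Category.assoc, ← κ_def, hκ, Category.assoc, h₃, Category.assoc]

lemma cosmash₃Incl_map {A B D Z : C} (s : A ⟶ Z) (k : B ⟶ Z) :
    cosmash₃Incl A B D ≫ cosmashMap (coprod.desc s k) (𝟙 D) =
      cosmash₃Map s k (𝟙 D) ≫ fold₂₁ Z D := by
  rw [← cancel_mono (cosmashι Z D), Category.assoc, cosmashMap_ι, ← Category.assoc, cosmash₃Incl_ι,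
    Category.assoc, fold₂₁_ι, ← Category.assoc, cosmash₃Map_ι, Category.assoc]
  congr 1
  ext <;> simp

lemma cosmash₃Map_comp {A A' A'' B B' B'' D D' D'' : C} (f : A ⟶ A') (f' : A' ⟶ A'') (g : B ⟶ B')
    (g' : B' ⟶ B'') (l : D ⟶ D') (l' : D' ⟶ D'') :
    cosmash₃Map (f ≫ f') (g ≫ g') (l ≫ l') = cosmash₃Map f g l ≫ cosmash₃Map f' g' l' := by
  have : Mono (cosmash₃ι A'' B'' D'') := inferInstanceAs (Mono (kernel.ι _))
  rw [← cancel_mono (cosmash₃ι A'' B'' D''), cosmash₃Map_ι, Category.assoc, cosmash₃Map_ι,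
    ← Category.assoc, cosmash₃Map_ι, Category.assoc, coprod.map_map, coprod.map_map]

lemma fold₂₁_naturality {A A' B B' : C} (f : A ⟶ A') (g : B ⟶ B') :
    fold₂₁ A B ≫ cosmashMap f g = cosmash₃Map f f g ≫ fold₂₁ A' B' := by
  rw [← cancel_mono (cosmashι A' B'), Category.assoc, cosmashMap_ι, ← Category.assoc, fold₂₁_ι,
    Category.assoc, Category.assoc, fold₂₁_ι, ← Category.assoc, ← Category.assoc, cosmash₃Map_ι]
  simp only [Category.assoc]
  congr 1
  ext <;> simp

lemma fold₁₂_naturality {A A' B B' : C} (f : A ⟶ A') (g : B ⟶ B') :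
    fold₁₂ A B ≫ cosmashMap f g = cosmash₃Map f g g ≫ fold₁₂ A' B' := by
  rw [← cancel_mono (cosmashι A' B'), Category.assoc, cosmashMap_ι, ← Category.assoc, fold₁₂_ι,
    Category.assoc, Category.assoc, fold₁₂_ι, ← Category.assoc, ← Category.assoc, cosmash₃Map_ι]
  simp only [Category.assoc]
  congr 1
  ext <;> simp

lemma conjCore_naturality {A A' : C} (f : A ⟶ A') :
    conjCore A ≫ f = cosmashMap f f ≫ conjCore A' := by
  rw [conjCore, conjCore, ← Category.assoc, cosmashMap_ι, Category.assoc, Category.assoc]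
  congr 1
  ext <;> simp

/-! ### Projective split extensions -/

namespace SSE

variable {B : C} {S T : SSE B}

omit [SemiAbelian C] in
lemma hom_ext_of_g {a b : S ⟶ T} (h : Hom.g a = Hom.g b) : a = b := by
  refine Hom.ext ?_ h
  rw [← cancel_mono T.ext.k, ← Hom.k_g a, ← Hom.k_g b, h]

/-- A morphism between the middle objects of split extensions over `B`, compatible with the split
epimorphisms and the sections, restricts to the kernel objects. -/
def homMk (g : S.ext.E ⟶ T.ext.E) (hp : g ≫ T.ext.p = S.ext.p) (hs : S.ext.s ≫ g = T.ext.s) :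
    Hom S T where
  f := T.ext.lift (S.ext.k ≫ g) (by rw [Category.assoc, hp, S.ext.k_p])
  g := g
  k_g := (T.ext.lift_k _ _).symm
  g_p := hp
  s_g := hs

/-- A morphism of split extensions over `B` that is a strong epimorphism on middle objects is a
regular epimorphism: it is the coequalizer of its kernel pair, which is computed on middle
objects. -/
lemma isRegularEpi_of_strongEpi_g (e : S ⟶ T) [StrongEpi (Hom.g e)] : IsRegularEpi e := by
  have := isRegularEpi_of_strongEpi (Hom.g e)
  let R : SSE B := ⟨_, SplitExtension.ofPoint (pullback.fst (Hom.g e) (Hom.g e) ≫ S.ext.p)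
    (pullback.lift S.ext.s S.ext.s rfl) (by simp [S.ext.s_p])⟩
  let r₁ : R ⟶ S := homMk (S := R) (pullback.fst (Hom.g e) (Hom.g e)) rfl
    (pullback.lift_fst _ _ _)
  have hp : pullback.snd (Hom.g e) (Hom.g e) ≫ S.ext.p =
      pullback.fst (Hom.g e) (Hom.g e) ≫ S.ext.p := by
    rw [← Hom.g_p e, ← Category.assoc, ← pullback.condition, Category.assoc]
  let r₂ : R ⟶ S := homMk (S := R) (pullback.snd (Hom.g e) (Hom.g e)) hp
    (pullback.lift_snd _ _ _)
  have w : r₁ ≫ e = r₂ ≫ e := hom_ext_of_g pullback.condition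
  refine ⟨⟨⟨R, r₁, r₂, w, Cofork.IsColimit.mk' _ fun c => ?_⟩⟩⟩
  have hc : pullback.fst (Hom.g e) (Hom.g e) ≫ Hom.g c.π =
      pullback.snd (Hom.g e) (Hom.g e) ≫ Hom.g c.π := congrArg Hom.g c.condition
  have hd := IsRegularEpi.fac (Hom.g e) (Hom.g c.π) (left_comp_eq_right_comp _ _ hc)
  refine ⟨homMk (IsRegularEpi.desc (Hom.g e) (Hom.g c.π) (left_comp_eq_right_comp _ _ hc))
    ?_ ?_, hom_ext_of_g hd, fun {m} hm => hom_ext_of_g ?_⟩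
  · rw [← cancel_epi (Hom.g e), ← Category.assoc, hd]
    exact (Hom.g_p c.π).trans (Hom.g_p e).symm
  · change T.ext.s ≫ _ = _
    rw [← Hom.s_g e, Category.assoc, hd]
    exact Hom.s_g c.π
  · rw [← cancel_epi (Hom.g e)]
    exact (congrArg Hom.g hm).trans hd.symm

/-- A strong epimorphism onto the middle object of a projective split extension that carries a
lifting of the section has a section compatible with that lifting. -/
lemma IsProjective.exists_section (hS : S.IsProjective) {E : C} (g : E ⟶ S.ext.E) [StrongEpi g]
    (b : B ⟶ E) (hb : b ≫ g = S.ext.s) :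
    ∃ σ : S.ext.E ⟶ E, σ ≫ g = 𝟙 _ ∧ S.ext.s ≫ σ = b := by
  let T : SSE B := ⟨_, SplitExtension.ofPoint (g ≫ S.ext.p) b
    (by rw [← Category.assoc, hb, S.ext.s_p])⟩
  let e : T ⟶ S := homMk (S := T) g rfl hb
  have : StrongEpi (Hom.g e) := ‹StrongEpi g›
  obtain ⟨⟨σ, hσ⟩⟩ := hS e (isRegularEpi_of_strongEpi_g e)
  exact ⟨Hom.g σ, congrArg Hom.g hσ, Hom.s_g σ⟩

end SSE

/-! ### Images of split extensions -/

namespace SplitExtension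

variable {B X B' X' : C} (S : SplitExtension B X) (S' : SplitExtension B' X')

lemma actionCore_naturality {f : X' ⟶ X} {g : S'.E ⟶ S.E} {l : B' ⟶ B}
    (hk : S'.k ≫ g = f ≫ S.k) (hs : S'.s ≫ g = l ≫ S.s) :
    S'.actionCore ≫ f = cosmashMap l f ≫ S.actionCore := by
  rw [← cancel_mono S.k, Category.assoc, ← hk, ← Category.assoc, actionCore_k, Category.assoc,
    Category.assoc, actionCore_k, ← Category.assoc (cosmashMap l f), cosmashMap_ι, Category.assoc]
  congr 1
  ext <;> simp [hk, hs]

/-- The image of a morphism of split extensions that is a strong epimorphism on the base: the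
middle object is the image of the morphism between the middle objects. -/
lemma exists_image {f : X' ⟶ X} {g : S'.E ⟶ S.E} {l : B' ⟶ B} [StrongEpi l]
    (hk : S'.k ≫ g = f ≫ S.k) (hs : S'.s ≫ g = l ≫ S.s) (hp : g ≫ S.p = S'.p ≫ l) :
    ∃ (Y : C) (T : SplitExtension B Y) (x : X' ⟶ Y) (j : Y ⟶ X), StrongEpi x ∧ Mono j ∧
      x ≫ j = f ∧ T.actionCore ≫ j = cosmashMap (𝟙 B) j ≫ S.actionCore := by
  obtain ⟨J, q, m, hq, hm, hqm⟩ : ∃ (J : C) (q : S'.E ⟶ J) (m : J ⟶ S.E),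
      StrongEpi q ∧ Mono m ∧ q ≫ m = g :=
    ⟨_, (Regular.strongEpiMonoFactorisation g).e, (Regular.strongEpiMonoFactorisation g).m,
      inferInstance, inferInstance, (Regular.strongEpiMonoFactorisation g).fac⟩
  have sq : CommSq (S'.s ≫ q) l m S.s := ⟨by rw [Category.assoc, hqm, hs]⟩
  let T : SplitExtension B _ := ofPoint (m ≫ S.p) sq.lift (by
    rw [← Category.assoc, sq.fac_right, S.s_p])
  let j : kernel (m ≫ S.p) ⟶ X := S.lift (kernel.ι (m ≫ S.p) ≫ m) (by simp)
  let x : X' ⟶ kernel (m ≫ S.p) := kernel.lift _ (S'.k ≫ q) (by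
    rw [Category.assoc, ← Category.assoc q, hqm, hp, ← Category.assoc, S'.k_p, zero_comp])
  have hj : j ≫ S.k = kernel.ι (m ≫ S.p) ≫ m := S.lift_k _ _
  refine ⟨_, T, x, j, ?_, ?_, ?_, ?_⟩
  · exact strongEpi_kernel T S' (g := q) (l := l) (kernel.lift_ι _ _ _).symm
      (by change q ≫ m ≫ S.p = _; rw [← Category.assoc, hqm, hp]) sq.fac_left.symm (hg := hq)
  · have : Mono (j ≫ S.k) := by rw [hj]; infer_instance
    exact mono_of_mono j S.k
  · rw [← cancel_mono S.k, Category.assoc, hj, kernel.lift_ι_assoc, Category.assoc, hqm, hk]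
  · exact actionCore_naturality S T (g := m) hj.symm (by
      rw [Category.id_comp]; exact sq.fac_right)

end SplitExtension

/-! ### Regular epimorphisms of crossed modules -/

/-- The conjugation action core of `A` belongs to a split extension with a retraction `π`: the
projections and the diagonal of `A ⨯ A`. -/
lemma exists_conjCore_eq (A : C) : ∃ (K : SplitExtension A A) (π : K.E ⟶ A),
    K.actionCore = conjCore A ∧ K.k ≫ π = 𝟙 A ∧ K.s ≫ π = 𝟙 A := by
  refine ⟨kernelSplitExtension (𝟙 A) (0 : A ⟶ A) (by simp) ⟨KernelFork.IsLimit.ofId _ rfl⟩,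
    pullback.snd _ _, ?_, pullback.lift_snd _ _ _, pullback.lift_snd _ _ _⟩
  simpa [cosmashMap_id, kernelCore] using kernelCore_comp (𝟙 A) (0 : A ⟶ A) (by simp)
    ⟨KernelFork.IsLimit.ofId _ rfl⟩

namespace XMod

variable {M N : XMod C}

/-- The crossed module of an object acting on itself by conjugation. -/
def conj (B : C) : XMod C where
  X := B
  A := B
  ψ := conjCore B
  bd := 𝟙 B
  isActionCore := (exists_conjCore_eq B).imp fun _ h => h.choose_spec.1
  precrossed := by simp [cosmashMap_id]
  peiffer := by simp [cosmashMap_id]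
  ternary := by
    have h : cosmash₃Map (𝟙 B) (𝟙 B) (𝟙 B) ≫ cosmash₃ι B B B = cosmash₃ι B B B := by
      rw [cosmash₃Map_ι, coprod.map_id_id, coprod.map_id_id, Category.comp_id]
    simp only [conjCore]
    rw [← Category.assoc (fold₁₂ B B), fold₁₂_ι, ← Category.assoc (fold₂₁ B B), fold₂₁_ι,
      ← Category.assoc (cosmash₃Map _ _ _), ← Category.assoc (cosmash₃Map _ _ _), h,
      Category.assoc, Category.assoc]
    congr 1
    ext <;> simp

lemma precrossed_comp (M : XMod C) {B : C} (u : M.A ⟶ B) :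
    M.ψ ≫ M.bd ≫ u = cosmashMap u (M.bd ≫ u) ≫ conjCore B := by
  rw [← Category.assoc, M.precrossed, Category.assoc, conjCore_naturality, ← Category.assoc,
    ← cosmashMap_comp, Category.id_comp]

/-- The functor `B ↦ conj B` is right adjoint to `M ↦ M.A`; this is the transpose of `u`. -/
def toConj (M : XMod C) {B : C} (u : M.A ⟶ B) : Hom M (conj B) where
  fX := M.bd ≫ u
  fA := u
  comm := (Category.comp_id _).symm
  equivariant := M.precrossed_comp u

lemma eq_toConj {B : C} (a : M ⟶ conj B) : a = M.toConj (Hom.fA a) :=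
  Hom.ext ((Category.comp_id _).symm.trans (Hom.comm a).symm) rfl

/-- `M ↦ M.A` preserves the coequalizers that present regular epimorphisms, as it has a right
adjoint. -/
instance isRegularEpi_fA (e : M ⟶ N) [IsRegularEpi e] : IsRegularEpi (Hom.fA e) := by
  refine ⟨⟨⟨_, Hom.fA (IsRegularEpi.left e), Hom.fA (IsRegularEpi.right e),
    congrArg Hom.fA (IsRegularEpi.w e), Cofork.IsColimit.mk' _ fun c => ?_⟩⟩⟩
  let u : M ⟶ conj c.pt := M.toConj c.π
  have hu : IsRegularEpi.left e ≫ u = IsRegularEpi.right e ≫ u := by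
    rw [eq_toConj (IsRegularEpi.left e ≫ u), eq_toConj (IsRegularEpi.right e ≫ u)]
    exact congrArg _ c.condition
  refine ⟨Hom.fA (IsRegularEpi.desc e u hu), congrArg Hom.fA (IsRegularEpi.fac e u hu),
    fun {m} hm => ?_⟩
  have : N.toConj m = IsRegularEpi.desc e u hu := by
    refine IsRegularEpi.uniq e u hu (N.toConj m) ?_
    rw [eq_toConj (e ≫ (N.toConj m : N ⟶ conj c.pt))]
    exact congrArg _ hm
  exact congrArg Hom.fA this

/-- The restriction of a crossed module to a subobject of its domain that is stable under the
action. -/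
def restrict (N : XMod C) {Y : C} (T : SplitExtension N.A Y) (j : Y ⟶ N.X) [Mono j]
    (h : T.actionCore ≫ j = cosmashMap (𝟙 N.A) j ≫ N.ψ) : XMod C where
  X := Y
  A := N.A
  ψ := T.actionCore
  bd := j ≫ N.bd
  isActionCore := ⟨T, rfl⟩
  precrossed := by
    rw [← Category.assoc, h, Category.assoc, N.precrossed, ← Category.assoc, ← cosmashMap_comp,
      Category.comp_id]
  peiffer := by
    rw [← cancel_mono j, Category.assoc, h, conjCore_naturality, ← N.peiffer, ← Category.assoc,
      ← Category.assoc, ← cosmashMap_comp, ← cosmashMap_comp]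
    simp
  ternary := by
    rw [← cancel_mono j]
    simp only [Category.assoc, h]
    rw [← Category.assoc (fold₁₂ _ _), fold₁₂_naturality, Category.assoc, N.ternary,
      ← Category.assoc (fold₂₁ _ _), fold₂₁_naturality]
    simp only [← Category.assoc, ← cosmash₃Map_comp]
    simp

/-- A regular epimorphism of crossed modules is a strong epimorphism on domains. The image of `M.X`
in `N.X` is stable under the action of `N.A`, and the morphism factors through the
crossed module that it carries. -/
lemma strongEpi_fX (e : M ⟶ N) [IsRegularEpi e] : StrongEpi (Hom.fX e) := by
  obtain ⟨SM, hM⟩ := M.isActionCore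
  obtain ⟨SN, hN⟩ := N.isActionCore
  obtain ⟨g, hk, hs, hp⟩ := SM.exists_hom_of_equivariant SN (f := Hom.fX e) (l := Hom.fA e)
    (by rw [hM, hN, Hom.equivariant e])
  obtain ⟨Y, T, x, j, hx, hj, hxj, hT⟩ := SN.exists_image SM hk hs hp
  rw [hN] at hT
  have hcomm : M.bd ≫ Hom.fA e = x ≫ j ≫ N.bd := by
    rw [Hom.comm e, ← hxj, Category.assoc]
  have hequiv : M.ψ ≫ x = cosmashMap (Hom.fA e) x ≫ T.actionCore := by
    rw [← cancel_mono j, Category.assoc, hxj, Hom.equivariant e, Category.assoc, hT, ← hxj,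
      ← Category.assoc (cosmashMap (Hom.fA e) x), ← cosmashMap_comp, Category.comp_id]
  let e' : M ⟶ N.restrict T j hT :=
    { fX := x
      fA := Hom.fA (M := M) (N := N) e
      comm := hcomm
      equivariant := hequiv }
  let i : N.restrict T j hT ⟶ N :=
    { fX := j
      fA := 𝟙 _
      comm := Category.comp_id _
      equivariant := hT }
  have he : e' ≫ i = e := Hom.ext hxj (Category.comp_id _)
  have : Mono i := ⟨fun a b hab => Hom.ext
    ((cancel_mono j).1 (congrArg Hom.fX hab))
    ((Category.comp_id _).symm.trans ((congrArg Hom.fA hab).trans (Category.comp_id _)))⟩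
  have : StrongEpi (e' ≫ i) := by rw [he]; infer_instance
  have : StrongEpi i := strongEpi_of_strongEpi e' i
  have : IsIso i := isIso_of_mono_of_strongEpi i
  have : IsIso j := ⟨Hom.fX (inv i), congrArg Hom.fX (IsIso.hom_inv_id i),
    congrArg Hom.fX (IsIso.inv_hom_id i)⟩
  rw [← hxj]
  infer_instance

/-- The codomain morphism of the internal reflexive graph of a crossed module, whose object of
arrows is the semidirect product. It is a component of the morphism to the split extension of the
conjugation action of `M.A` on itself; it exists by the precrossed module condition. -/
lemma exists_codomain (M : XMod C) (S : SplitExtension M.A M.X) (hS : S.actionCore = M.ψ) :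
    ∃ c : S.E ⟶ M.A, S.k ≫ c = M.bd ∧ S.s ≫ c = 𝟙 _ := by
  obtain ⟨K, π, hK, hkπ, hsπ⟩ := exists_conjCore_eq M.A
  obtain ⟨g, hk, hs, -⟩ := S.exists_hom_of_equivariant K (f := M.bd) (l := 𝟙 _)
    (by rw [hK, hS, M.precrossed])
  refine ⟨g ≫ π, ?_, ?_⟩
  · rw [← Category.assoc, hk, Category.assoc, hkπ, Category.comp_id]
  · rw [← Category.assoc, hs, Category.assoc, hsπ, Category.comp_id]

end XMod

/-! ### Lifting along regular epimorphisms of crossed modules -/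

lemma SplitExtension.cosmashMap_s_kernelCore {B X : C} (S : SplitExtension B X) :
    cosmashMap S.s (𝟙 X) ≫ kernelCore S.k S.p S.k_p S.isKernel = S.actionCore := by
  rw [← cancel_mono S.k, Category.assoc, kernelCore_comp, actionCore_k, ← Category.assoc,
    ← cosmashMap_comp, conjCore, ← Category.assoc, cosmashMap_ι, Category.assoc]
  congr 1
  ext <;> simp

/-- Equivariance under the conjugation action of the middle object `E` of a split extension can be
tested on `B`. On the kernel object it is the Peiffer condition, and on the cosmash product of the
two it is the ternary condition. -/
lemma SplitExtension.equivariant_of_equivariant_s {B X : C} (S : SplitExtension B X) (M : XMod C)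
    (f : X ⟶ M.X) (u : S.E ⟶ M.A) (hu : S.k ≫ u = f ≫ M.bd)
    (h : S.actionCore ≫ f = cosmashMap (S.s ≫ u) f ≫ M.ψ) :
    kernelCore S.k S.p S.k_p S.isKernel ≫ f = cosmashMap u f ≫ M.ψ := by
  have hX := S.toXMod.peiffer
  have hT := S.toXMod.ternary
  change cosmashMap S.k (𝟙 X) ≫ kernelCore S.k S.p S.k_p S.isKernel = conjCore X at hX
  change fold₁₂ S.E X ≫ kernelCore S.k S.p S.k_p S.isKernel =
    cosmash₃Map (𝟙 S.E) S.k (𝟙 X) ≫ fold₂₁ S.E X ≫ kernelCore S.k S.p S.k_p S.isKernel at hT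
  have hs := S.cosmashMap_s_kernelCore
  generalize kernelCore S.k S.p S.k_p S.isKernel = χ at hX hT hs ⊢
  rw [← cancel_epi (cosmashMap (coprod.desc S.s S.k) (𝟙 X))]
  apply cosmash_coprod_hom_ext
  · rw [← Category.assoc, ← Category.assoc, ← Category.assoc, ← Category.assoc, ← cosmashMap_comp,
      ← cosmashMap_comp, coprod.inl_desc]
    simp only [Category.comp_id, Category.id_comp]
    rw [hs, h]
  · rw [← Category.assoc, ← Category.assoc, ← Category.assoc, ← Category.assoc, ← cosmashMap_comp,
      ← cosmashMap_comp, coprod.inr_desc]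
    simp only [Category.comp_id, Category.id_comp]
    rw [hX, hu, conjCore_naturality, ← M.peiffer, ← Category.assoc, ← cosmashMap_comp,
      Category.comp_id]
  · have h₁ : cosmash₃Map S.s S.k (𝟙 X) ≫ fold₂₁ S.E X ≫ χ = fold₁₂ B X ≫ S.actionCore := by
      rw [← hs, ← Category.assoc (fold₁₂ B X), fold₁₂_naturality, Category.assoc, hT,
        ← Category.assoc (cosmash₃Map S.s (𝟙 X) (𝟙 X)), ← cosmash₃Map_comp]
      simp
    have h₂ : cosmash₃Map S.s S.k (𝟙 X) ≫ fold₂₁ S.E X ≫ cosmashMap u f ≫ M.ψ =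
        fold₁₂ B X ≫ cosmashMap (S.s ≫ u) f ≫ M.ψ := by
      rw [← Category.assoc (fold₂₁ _ _), fold₂₁_naturality, ← Category.assoc (fold₁₂ _ _),
        fold₁₂_naturality, Category.assoc, Category.assoc, M.ternary,
        ← Category.assoc (cosmash₃Map _ _ _), ← Category.assoc (cosmash₃Map (S.s ≫ u) f f),
        ← cosmash₃Map_comp, ← cosmash₃Map_comp, hu]
      simp
    rw [← Category.assoc, cosmash₃Incl_map, ← Category.assoc (cosmash₃Incl _ _ _),
      cosmash₃Incl_map, Category.assoc, Category.assoc, h₂, ← h, ← Category.assoc (fold₂₁ _ _),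
      ← Category.assoc (cosmash₃Map _ _ _), h₁, Category.assoc]

/-- Given a lifting `t` of the codomain component of a morphism to `N` along the section of a
projective split extension, the whole morphism lifts along a regular epimorphism to `N`. -/
lemma exists_lift_of_projective {P : C} (S : SSE P) (hS : S.IsProjective) {M N : XMod C}
    (e : M ⟶ N) [IsRegularEpi e] (fX : S.X ⟶ N.X) (fA : S.ext.E ⟶ N.A)
    (f_comm : S.ext.k ≫ fA = fX ≫ N.bd)
    (f_equiv : kernelCore S.ext.k S.ext.p S.ext.k_p S.ext.isKernel ≫ fX =
      cosmashMap fA fX ≫ N.ψ)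
    (t : P ⟶ M.A) (ht : t ≫ XMod.Hom.fA e = S.ext.s ≫ fA) :
    ∃ (φ : S.X ⟶ M.X) (u : S.ext.E ⟶ M.A), S.ext.k ≫ u = φ ≫ M.bd ∧
      kernelCore S.ext.k S.ext.p S.ext.k_p S.ext.isKernel ≫ φ = cosmashMap u φ ≫ M.ψ ∧
      φ ≫ XMod.Hom.fX e = fX ∧ u ≫ XMod.Hom.fA e = fA := by
  have := XMod.strongEpi_fX e
  obtain ⟨SM, hM⟩ := M.isActionCore
  obtain ⟨SN, hN⟩ := N.isActionCore
  obtain ⟨g, gk, gs, gp⟩ := SM.exists_hom_of_equivariant SN (f := XMod.Hom.fX e)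
    (l := XMod.Hom.fA e) (by rw [hM, hN, XMod.Hom.equivariant e])
  obtain ⟨c, ck, cs⟩ := M.exists_codomain SM hM
  obtain ⟨γ, γk, γs, γp⟩ := S.ext.exists_hom_of_equivariant SN (f := fX) (l := S.ext.s ≫ fA) (by
    rw [← SplitExtension.cosmashMap_s_kernelCore, Category.assoc, f_equiv, hN, ← Category.assoc,
      ← cosmashMap_comp, Category.id_comp])
  have : StrongEpi g := SplitExtension.strongEpi_middle SN SM gk gs
  have := strongEpi_pullback_lift SM.s_p gp gs
  have ha : γ ≫ SN.p = (S.ext.p ≫ t) ≫ XMod.Hom.fA e := by rw [γp, Category.assoc, ht]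
  have hab : S.ext.s ≫ pullback.lift γ (S.ext.p ≫ t) ha =
      (t ≫ SM.s) ≫ pullback.lift g SM.p gp := by
    apply pullback.hom_ext
    · simp only [Category.assoc, pullback.lift_fst]
      rw [γs, gs, ← Category.assoc t, ht]
    · simp only [Category.assoc, pullback.lift_snd, SM.s_p]
      rw [← Category.assoc, S.ext.s_p, Category.id_comp, Category.comp_id]
  -- Split the pullback `Z ×_{E_N ×_{N.A} M.A} E_M ⟶ Z`, with section of `P` induced by `t`.
  obtain ⟨σ, hσ, hsσ⟩ := hS.exists_section
    (pullback.fst (pullback.lift γ (S.ext.p ≫ t) ha) (pullback.lift g SM.p gp))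
    (pullback.lift S.ext.s (t ≫ SM.s) hab) (pullback.lift_fst _ _ _)
  obtain ⟨γ', γ'_def⟩ : ∃ γ' : S.ext.E ⟶ SM.E, γ' = σ ≫ pullback.snd _ _ := ⟨_, rfl⟩
  have hγ' : γ' ≫ pullback.lift g SM.p gp = pullback.lift γ (S.ext.p ≫ t) ha := by
    rw [γ'_def, Category.assoc, ← pullback.condition, ← Category.assoc, hσ, Category.id_comp]
  have hγ'g : γ' ≫ g = γ := by simpa using congrArg (· ≫ pullback.fst _ _) hγ'
  have hγ'p : γ' ≫ SM.p = S.ext.p ≫ t := by simpa using congrArg (· ≫ pullback.snd _ _) hγ'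
  have hγ's : S.ext.s ≫ γ' = t ≫ SM.s := by
    rw [γ'_def, ← Category.assoc, hsσ, pullback.lift_snd]
  have hk0 : (S.ext.k ≫ γ') ≫ SM.p = 0 := by
    rw [Category.assoc, hγ'p, ← Category.assoc, S.ext.k_p, zero_comp]
  have hφ : SM.lift _ hk0 ≫ SM.k = S.ext.k ≫ γ' := SM.lift_k _ _
  generalize SM.lift _ hk0 = φ at hφ
  have hφX : φ ≫ XMod.Hom.fX e = fX := by
    rw [← cancel_mono SN.k, Category.assoc, ← gk, ← Category.assoc, hφ, Category.assoc, hγ'g, γk]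
  have hsu : S.ext.s ≫ γ' ≫ c = t := by
    rw [← Category.assoc, hγ's, Category.assoc, cs, Category.comp_id]
  have hku : S.ext.k ≫ γ' ≫ c = φ ≫ M.bd := by
    rw [← Category.assoc, ← hφ, Category.assoc, ck]
  refine ⟨φ, γ' ≫ c, hku, S.ext.equivariant_of_equivariant_s M φ _ hku ?_, hφX,
    S.ext.hom_ext ?_ ?_⟩
  · rw [hsu, ← hM]
    exact SplitExtension.actionCore_naturality SM S.ext hφ.symm hγ's
  · rw [← Category.assoc, hku, Category.assoc, XMod.Hom.comm e, ← Category.assoc, hφX, f_comm]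
  · rw [← Category.assoc, hsu, ht]

end

end SemiAb

theorem mainTheorem1 {C : Type u} [Category.{v} C] [HasZeroMorphisms C] [SemiAb.SemiAbelian C]
    (P : C) (hP : SemiAb.IsProjective P)
    (S : SemiAb.SSE P) (hS : S.IsProjective) :
    SemiAb.IsProjective S.ext.toXMod := by
  intro M N e f he
  obtain ⟨fX, fA, f_comm, f_equiv⟩ := f
  obtain ⟨t, ht⟩ := hP (SemiAb.XMod.Hom.fA e) (S.ext.s ≫ fA) inferInstance
  obtain ⟨φ, u, hku, hφ, hφX, huA⟩ :=
    SemiAb.exists_lift_of_projective S hS e fX fA f_comm f_equiv t ht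
  exact ⟨⟨φ, u, hku, hφ⟩, SemiAb.XMod.Hom.ext hφX huA⟩
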